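/- Theorem 5.7. Let $R$ be a (not necessarily commutative) semiring with identity $1\neq 0$ and absorbing zero $0r=r0=0$. Call $R$ simple if its only congruences are the diagonal and the universal one and its only two-sided ideals are $0$ and $R$. Let $\mathbf{B}=\{0,1\}$ be the Boolean semifield ($1+1=1$). The following conditions are equivalent: (i) $R$ is simple and has an infinite element, i.e. an element $\infty\in R$ with $r+\infty=\infty$ for all $r\in R$; (ii) $R$ is Morita equivalent to $\mathbf{B}$, i.e. the categories of unital left semimodules over $R$ and over $\mathbf{B}$ are equivalent via additive functors; (iii) $R\cong\mathbf{E}_M$ as semirings for some finite distributive lattice $M$ with more than one element, where $\mathbf{E}_M$ is the semiring of all endomorphisms of the monoid $(M,\vee,0_M)$ ($0_M$ the least element of $M$) under pointwise join and composition; (iv) $R$ is a complete simple semiring. Here $R$ is complete if to every family $(m_i)_{i\in\Omega}$ of elements of $R$, for every index set $\Omega$, a sum $\sum_{i\in\Omega}m_i\in R$ can be assigned so that: the empty sum is $0$; a one-term sum is its term; a two-term sum is the sum of the two terms in $R$; $\sum_{i\in\Omega}m_i=\sum_{j\in\Lambda}\big(\sum_{i\in\Omega_j}m_i\big)$ for every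 partition $\Omega=\bigsqcup_{j\in\Lambda}\Omega_j$ into nonempty subsets; and $r\sum_i m_i=\sum_i rm_i$ and $(\sum_i m_i)r=\sum_i m_ir$ for all $r\in R$. -/

import Mathlib

universe u v

/-! ### The Boolean semifield -/

/-- The Boolean semifield `𝐁 = {0, 1}`: addition is "or" (so `1 + 1 = 1`), multiplication
is "and". -/
def BooleanSemifield : Type := Bool

namespace BooleanSemifield

instance : DecidableEq BooleanSemifield := inferInstanceAs (DecidableEq Bool)

instance : Fintype BooleanSemifield := inferInstanceAs (Fintype Bool)

instance : Zero BooleanSemifield := ⟨false⟩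

instance : Add BooleanSemifield := ⟨Bool.or⟩

instance : CommSemiring BooleanSemifield where
  mul := Bool.and
  one := true
  add_assoc := by decide
  zero_add := by decide
  add_zero := by decide
  add_comm := by decide
  mul_assoc := by decide
  one_mul := by decide
  mul_one := by decide
  mul_comm := by decide
  left_distrib := by decide
  right_distrib := by decide
  zero_mul := by decide
  mul_zero := by decide
  nsmul := nsmulRec

end BooleanSemifield

/-! ### Simple semirings and infinite elements -/

/-- The diagonal and the universal congruence are the only congruences on `R`. -/
def IsCongruenceSimple (R : Type u) [Semiring R] : Prop :=
  ∀ c : RingCon R, c = ⊥ ∨ c = ⊤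

/-- `0` and `R` are the only two-sided ideals of `R`. -/
def IsIdealSimple (R : Type u) [Semiring R] : Prop :=
  ∀ I : Ideal R, I.IsTwoSided → I = ⊥ ∨ I = ⊤

/-- `R` is simple: both congruence-simple and ideal-simple. -/
def IsSimpleSemiring (R : Type u) [Semiring R] : Prop :=
  IsCongruenceSimple R ∧ IsIdealSimple R

/-- `R` has an infinite, i.e. additively absorbing, element. -/
def HasInfiniteElement (R : Type u) [Semiring R] : Prop :=
  ∃ a : R, ∀ r : R, r + a = a

/-! ### Morita equivalence -/

/-- A functor between categories of left semimodules is additive if it respects the zero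
morphisms and the pointwise addition of morphisms. -/
def IsAdditiveFunctor {R : Type u} {S : Type v} [Semiring R] [Semiring S]
    (F : CategoryTheory.Functor
      (SemimoduleCat.{max u v} R) (SemimoduleCat.{max u v} S)) : Prop :=
  ∀ M N : SemimoduleCat.{max u v} R,
    F.map (0 : M ⟶ N) = 0 ∧ ∀ f g : M ⟶ N, F.map (f + g) = F.map f + F.map g

/-- `R` and `S` are Morita equivalent: their categories of (unital) left semimodules are
equivalent via additive functors. -/
def AreMoritaEquivalent (R : Type u) (S : Type v) [Semiring R] [Semiring S] : Prop :=
  ∃ e : CategoryTheory.Equivalence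
      (SemimoduleCat.{max u v} R) (SemimoduleCat.{max u v} S),
    IsAdditiveFunctor.{u, v} e.functor ∧ IsAdditiveFunctor.{v, u} e.inverse

/-! ### The endomorphism semiring of a join-semilattice with zero -/

/-- The idempotent commutative monoid `(M, ∨, ⊥)` of a join-semilattice with least element. -/
def JoinMonoid (M : Type u) : Type u := M

namespace JoinMonoid

instance (M : Type u) [SemilatticeSup M] [OrderBot M] : Zero (JoinMonoid M) := ⟨(⊥ : M)⟩

instance (M : Type u) [SemilatticeSup M] [OrderBot M] : Add (JoinMonoid M) :=
  ⟨fun a b : M => (a ⊔ b : M)⟩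

instance (M : Type u) [SemilatticeSup M] [OrderBot M] : AddCommMonoid (JoinMonoid M) where
  add_assoc := fun a b c : M => sup_assoc a b c
  zero_add := fun a : M => bot_sup_eq a
  add_zero := fun a : M => sup_bot_eq a
  add_comm := fun a b : M => sup_comm a b
  nsmul := nsmulRec

end JoinMonoid

/-- The endomorphism semiring `𝐄_M` of the monoid `(M, ∨, ⊥)`: addition is the pointwise join
and multiplication is composition. -/
abbrev EndSemiring (M : Type u) [SemilatticeSup M] [OrderBot M] : Type u :=
  AddMonoid.End (JoinMonoid M)

/-! ### Complete semirings -/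

/-- An infinitary summation on a commutative monoid: a sum `sum m` for every index type `Ω` and
every family `m : Ω → M`, which extends the empty, one-term and two-term sums and
is compatible with partitions of the index set. -/
structure CompleteSummation (M : Type u) [AddCommMonoid M] where
  /-- the sum of a family -/
  sum : ∀ {Ω : Type u}, (Ω → M) → M
  sum_empty : ∀ {Ω : Type u} [IsEmpty Ω] (m : Ω → M), sum m = 0
  sum_singleton : ∀ {Ω : Type u} (i : Ω), (∀ k, k = i) → ∀ m : Ω → M, sum m = m i
  sum_pair : ∀ {Ω : Type u} (i j : Ω), i ≠ j → (∀ k, k = i ∨ k = j) →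
    ∀ m : Ω → M, sum m = m i + m j
  sum_partition : ∀ {Ω Λ : Type u} (P : Λ → Set Ω), (∀ j, (P j).Nonempty) →
    Pairwise (fun j k => Disjoint (P j) (P k)) → (⋃ j, P j) = Set.univ →
    ∀ m : Ω → M, sum m = sum (fun j : Λ => sum (fun i : P j => m i))

/-- `R` is a complete semiring: for some infinitary summation, it is complete both as a left and
as a right semimodule over itself. -/
def IsCompleteSemiring (R : Type u) [Semiring R] : Prop :=
  ∃ S : CompleteSummation R,
    (∀ {Ω : Type u} (r : R) (m : Ω → R), r * S.sum m = S.sum (fun i => r * m i)) ∧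
    (∀ {Ω : Type u} (r : R) (m : Ω → R), S.sum m * r = S.sum (fun i => m i * r))

/-!
Everything is measured against two kinds of data in `R` that express, in different ways, that `R`
is a "matrix ring up to a projection" over the Boolean semifield.

* *Full idempotents of rank one* (`FullRankOneIdempotent`): an idempotent `e ≠ 0` with
  `e R e = {0, e}` and `R e R = R`. The infinite element of a simple semiring is one
  (`IsIdealSimple.exists_fullRankOneIdempotent`). Given such an `e`, a semimodule `N` is recovered
  from `e N`, so that `N ↦ e N` is a Morita equivalence to the Boolean semifield
  (`FullRankOneIdempotent.areMoritaEquivalent`). Moreover `R` is the full endomorphism semiring of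
  the idempotent monoid `R e`, which is a retract of a finite power of the Boolean semifield and
  therefore a finite distributive lattice (`FullRankOneIdempotent.exists_ringEquiv_endSemiring`).
* *Boolean matrix units* (`BooleanMatrixUnits`): elements `E k l` with `∑ E i i = 1` such that
  `E k i * r * E j l` is `0` or `E k l`. They exist in the endomorphism semiring of a finite
  distributive lattice, where every element is a join of sup-primes
  (`EndSemiring.booleanMatrixUnits`), and in every semiring Morita equivalent to the Boolean
  semifield, where they are built from the trace ideal of the semimodule corresponding to the
  Boolean semifield (`AreMoritaEquivalent.exists_booleanMatrixUnits`). Sandwiching by matrix units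
  collapses every nontrivial congruence and inflates every nonzero ideal, so that their existence
  implies simplicity (`BooleanMatrixUnits.isSimpleSemiring`), and their sum is infinite
  (`BooleanMatrixUnits.hasInfiniteElement`).

As for completeness, a finite additively idempotent semiring is complete by taking joins
(`isCompleteSemiring_of_finite`), and in a complete semiring the sum of all elements, each repeated
countably often, is infinite (`CompleteSummation.exists_infinite`).
-/

theorem add_self_of_one_add_one {R : Type u} [Semiring R] (h : (1 : R) + 1 = 1) (r : R) :
    r + r = r := by
  simpa [mul_add] using congrArg (r * ·) h

/-! ### Boolean matrix units -/

/-- A system of Boolean matrix units in a semiring `R`: a family `E k l`, indexed by a finite set,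
such that the `E i i` add up to `1` and each `E k i * r * E j l` is either `0` or `E k l`, the
alternative depending only on `r`, `i` and `j`. The matrix units themselves need not be
orthogonal: in the endomorphism semiring of a finite distributive lattice, `E k l` is the rank one
map sending `x` to `k` if `l ≤ x` and to `⊥` otherwise, for sup-irreducible `k` and `l`. -/
structure BooleanMatrixUnits (ι : Type v) [Fintype ι] (R : Type u) [Semiring R] where
  /-- the matrix units -/
  E : ι → ι → R
  sum_diag : ∑ i, E i i = 1
  mul_mul : ∀ (r : R) (i j : ι),
    (∀ k l, E k i * r * E j l = 0) ∨ (∀ k l, E k i * r * E j l = E k l)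
  one_add_one : (1 : R) + 1 = 1

namespace BooleanMatrixUnits

variable {ι : Type v} [Fintype ι] {R : Type u} [Semiring R]

/-- Matrix units are transported along isomorphisms of semirings. -/
def map {S : Type*} [Semiring S] (m : BooleanMatrixUnits ι R) (f : R ≃+* S) :
    BooleanMatrixUnits ι S where
  E k l := f (m.E k l)
  sum_diag := by rw [← map_sum, m.sum_diag, map_one]
  mul_mul s i j := by
    refine (m.mul_mul (f.symm s) i j).imp (fun h k l => ?_) (fun h k l => ?_)
    · rw [← map_zero f, ← h k l]; simp
    · rw [← h k l]; simp
  one_add_one := by rw [← map_one f, ← map_add, m.one_add_one]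

theorem eq_sum (m : BooleanMatrixUnits ι R) (r : R) :
    r = ∑ i, ∑ j, m.E i i * r * m.E j j := by
  simp_rw [← Finset.mul_sum, m.sum_diag, mul_one, ← Finset.sum_mul, m.sum_diag, one_mul]

/-- The sum of all matrix units is infinite, since every element is a sum of matrix units. -/
theorem hasInfiniteElement (m : BooleanMatrixUnits ι R) : HasInfiniteElement R := by
  refine ⟨∑ i, ∑ j, m.E i j, fun r => ?_⟩
  conv_lhs => rw [m.eq_sum r]
  simp_rw [← Finset.sum_add_distrib]
  refine Finset.sum_congr rfl fun i _ => Finset.sum_congr rfl fun j _ => ?_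
  obtain h | h := m.mul_mul r i j <;> rw [h i j]
  · rw [zero_add]
  · exact add_self_of_one_add_one m.one_add_one _

/-- Two distinct elements have distinct matrix coefficients at some `i`, `j`, so one of them is
sent to `0` and the other to `E k l` by `E k i * _ * E j l`. -/
theorem exists_separation (m : BooleanMatrixUnits ι R) {r s : R} (h : r ≠ s) : ∃ i j,
    (∀ k l, m.E k i * r * m.E j l = 0 ∧ m.E k i * s * m.E j l = m.E k l) ∨
    (∀ k l, m.E k i * s * m.E j l = 0 ∧ m.E k i * r * m.E j l = m.E k l) := by
  by_contra! H
  refine h ?_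
  rw [m.eq_sum r, m.eq_sum s]
  refine Finset.sum_congr rfl fun i _ => Finset.sum_congr rfl fun j _ => ?_
  obtain ⟨⟨k, l, h1⟩, ⟨k', l', h2⟩⟩ := H i j
  obtain hr | hr := m.mul_mul r i j <;> obtain hs | hs := m.mul_mul s i j
  · rw [hr, hs]
  · exact (h1 (hr k l) (hs k l)).elim
  · exact (h2 (hs k' l') (hr k' l')).elim
  · rw [hr, hs]

theorem isCongruenceSimple (m : BooleanMatrixUnits ι R) : IsCongruenceSimple R := by
  intro c
  by_cases hc : ∀ r s, c r s → r = s
  · left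
    ext r s
    exact ⟨hc r s, fun h => by obtain rfl : r = s := h; exact c.refl r⟩
  right
  push Not at hc
  obtain ⟨r, s, hrs, hne⟩ := hc
  have hE : ∀ k l, c (m.E k l) 0 := by
    intro k l
    obtain ⟨i, j, H | H⟩ := m.exists_separation hne
    · have := c.mul (c.mul (c.refl (m.E k i)) (c.symm hrs)) (c.refl (m.E j l))
      rwa [(H k l).1, (H k l).2] at this
    · have := c.mul (c.mul (c.refl (m.E k i)) hrs) (c.refl (m.E j l))
      rwa [(H k l).1, (H k l).2] at this
  have h1 : c 1 0 := by
    have := c.finsetSum Finset.univ (fun i _ => hE i i)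
    rwa [m.sum_diag, Finset.sum_const_zero] at this
  have h0 : ∀ x, c x 0 := fun x => by simpa using c.mul (c.refl x) h1
  ext x y
  exact ⟨fun _ => trivial, fun _ => c.trans (h0 x) (c.symm (h0 y))⟩

theorem isIdealSimple (m : BooleanMatrixUnits ι R) : IsIdealSimple R := by
  intro I hI
  by_cases h : I = ⊥
  · exact Or.inl h
  right
  obtain ⟨r, hr, hr0⟩ := Submodule.exists_mem_ne_zero_of_ne_bot h
  rw [Ideal.eq_top_iff_one, ← m.sum_diag]
  refine I.sum_mem fun k _ => ?_
  obtain ⟨i, j, H | H⟩ := m.exists_separation hr0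
  · rw [← (H k k).2]
    simp
  · rw [← (H k k).2]
    exact hI.mul_mem_of_left _ (I.mul_mem_left _ hr)

theorem isSimpleSemiring (m : BooleanMatrixUnits ι R) : IsSimpleSemiring R :=
  ⟨m.isCongruenceSimple, m.isIdealSimple⟩

end BooleanMatrixUnits

/-! ### Full idempotents of rank one -/

/-- A full idempotent of Boolean rank one: an idempotent `e ≠ 0` of an additively idempotent
semiring `R` with `e R e = {0, e}` (a copy of the Boolean semifield) and `R e R = R`, the latter
witnessed by an explicit expression of `1`. -/
structure FullRankOneIdempotent (n : ℕ) (R : Type u) [Semiring R] where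
  /-- the idempotent -/
  e : R
  /-- the left coefficients in an expression of `1` -/
  a : Fin n → R
  /-- the right coefficients in an expression of `1` -/
  b : Fin n → R
  mul_self : e * e = e
  ne_zero : e ≠ 0
  mul_mul : ∀ r, e * r * e = 0 ∨ e * r * e = e
  sum_eq_one : ∑ i, a i * (e * b i) = 1
  one_add_one : (1 : R) + 1 = 1

/-- The infinite element `w` of a simple semiring is a full idempotent of rank one: `R w R = R`
by ideal-simplicity, so that `1` inherits additive idempotency from `w`; and for `r ≠ 0` the
element `w r w` is above every summand `x r y` of an expression of `w` as an element of
`R r R`, so it is `w`. -/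
theorem IsIdealSimple.exists_fullRankOneIdempotent {R : Type u} [Semiring R] [Nontrivial R]
    (hR : IsIdealSimple R) (hinf : HasInfiniteElement R) :
    ∃ n, Nonempty (FullRankOneIdempotent n R) := by
  obtain ⟨w, hw⟩ := hinf
  have hw0 : w ≠ 0 := by
    rintro rfl
    exact one_ne_zero ((add_zero (1 : R)).symm.trans (hw 1))
  have key : ∀ r : R, r ≠ 0 → ∀ t : R,
      ∃ (n : ℕ) (a b : Fin n → R), ∑ i, a i * (r * b i) = t := by
    intro r hr t
    have hI : (Ideal.span (Set.range fun x : R => r * x)).IsTwoSided := by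
      refine ⟨fun {s} y hs => ?_⟩
      induction hs using Submodule.span_induction with
      | mem s hs =>
        obtain ⟨x, rfl⟩ := hs
        exact Ideal.subset_span ⟨x * y, (mul_assoc _ _ _).symm⟩
      | zero => simp
      | add s s' _ _ h h' => rw [add_mul]; exact Ideal.add_mem _ h h'
      | smul x s _ h => rw [smul_eq_mul, mul_assoc]; exact Ideal.mul_mem_left _ _ h
    have htop : t ∈ Ideal.span (Set.range fun x : R => r * x) := by
      rw [(hR _ hI).resolve_left ?_]
      · trivial
      · intro hbot
        have : r ∈ Ideal.span (Set.range fun x : R => r * x) :=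
          Ideal.subset_span ⟨1, mul_one r⟩
        rw [hbot] at this
        exact hr this
    obtain ⟨n, a, g, hg⟩ := Submodule.mem_span_set'.1 htop
    choose b hb using fun i => (g i).2
    exact ⟨n, a, b, by
      rw [← hg]
      exact Finset.sum_congr rfl fun i _ => congrArg (a i * ·) (hb i)⟩
  obtain ⟨n, a, b, h1⟩ := key w hw0 1
  have h11 : (1 : R) + 1 = 1 := by
    rw [← h1, ← Finset.sum_add_distrib]
    refine Finset.sum_congr rfl fun i _ => ?_
    rw [← mul_add, ← add_mul, hw]
  have hww : ∀ r, r ≠ 0 → w * r * w = w := by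
    intro r hr
    obtain ⟨m, x, y, hxy⟩ := key r hr w
    have hle : ∀ s : Finset (Fin m), ∑ i ∈ s, x i * (r * y i) + w * r * w = w * r * w := by
      intro s
      induction s using Finset.cons_induction with
      | empty => simp
      | cons i s hi ih =>
        rw [Finset.sum_cons, add_assoc, ih]
        -- `x i * r * y i` is a summand of `(x i + w) * r * (y i + w) = w * r * w`.
        have hrr := add_self_of_one_add_one h11 (x i * (r * y i))
        calc x i * (r * y i) + w * r * w
            = x i * (r * y i) + (x i + w) * r * (y i + w) := by rw [hw, hw]
          _ = (x i * (r * y i) + x i * (r * y i)) + x i * r * w + w * r * y i + w * r * w := by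
              simp only [add_mul, mul_add, mul_assoc]; abel
          _ = (x i + w) * r * (y i + w) := by
              rw [hrr]; simp only [add_mul, mul_add, mul_assoc]; abel
          _ = w * r * w := by rw [hw, hw]
    have := hle Finset.univ
    rw [hxy, add_comm, hw] at this
    exact this.symm
  refine ⟨n, ⟨⟨w, a, b, ?_, hw0, fun r => ?_, h1, h11⟩⟩⟩
  · simpa using hww 1 one_ne_zero
  · by_cases hr : r = 0
    · left; simp [hr]
    · exact Or.inr (hww r hr)

/-! ### Complete semirings -/

/-- A finite additively idempotent semiring is complete: finite joins exist, and a join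
only depends on the range of the family. -/
theorem isCompleteSemiring_of_finite {R : Type u} [Semiring R] [Finite R]
    (h : (1 : R) + 1 = 1) : IsCompleteSemiring R := by
  classical
  let _ : IdemSemiring R := IdemSemiring.ofSemiring (add_self_of_one_add_one h)
  let S : ∀ {Ω : Type u}, (Ω → R) → R := fun m => (Set.toFinite (Set.range m)).toFinset.sup id
  have hS : ∀ {Ω : Type u} (m : Ω → R) (x : R), S m ≤ x ↔ ∀ i, m i ≤ x := by
    intro Ω m x
    simp [S, Finset.sup_le_iff]
  have hsum : ∀ s : Finset R, s.sup id = ∑ x ∈ s, x := by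
    intro s
    induction s using Finset.cons_induction with
    | empty => rfl
    | cons a s ha ih => rw [Finset.sup_cons, Finset.sum_cons, ih, id, add_eq_sup]
  have hmap : ∀ {Ω : Type u} (f : R →+ R) (m : Ω → R), f (S m) = S (fun i => f (m i)) := by
    intro Ω f m
    have hf : ∀ a b, a ≤ b → f a ≤ f b := fun a b hab => by
      rw [← sup_eq_right, ← add_eq_sup] at hab ⊢
      rw [← map_add, hab]
    refine le_antisymm ?_ ((hS _ _).2 fun i => hf _ _ ((hS m _).1 le_rfl i))
    have : f (S m) = (Set.toFinite (Set.range m)).toFinset.sup f := by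
      refine Finset.apply_sup_eq_sup_comp f (fun a b => ?_) (map_zero f)
      rw [← add_eq_sup, map_add, add_eq_sup]
    rw [this, Finset.sup_le_iff]
    intro x hx
    obtain ⟨i, rfl⟩ := (Set.Finite.mem_toFinset _).1 hx
    exact (hS (fun i => f (m i)) _).1 le_rfl i
  refine ⟨⟨S, ?_, ?_, ?_, ?_⟩, fun r m => hmap (AddMonoidHom.mulLeft r) m,
    fun r m => hmap (AddMonoidHom.mulRight r) m⟩
  · intro Ω _ m
    exact eq_of_forall_ge_iff fun x => by
      rw [hS]
      exact ⟨fun _ => bot_le, fun _ => isEmptyElim⟩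
  · intro Ω i hi m
    exact eq_of_forall_ge_iff fun x => by
      rw [hS]; exact ⟨fun H => H i, fun H k => by rwa [hi k]⟩
  · intro Ω i j _ hij m
    refine eq_of_forall_ge_iff fun x => ?_
    rw [hS, add_eq_sup, sup_le_iff]
    refine ⟨fun H => ⟨H i, H j⟩, fun H k => ?_⟩
    obtain rfl | rfl := hij k
    exacts [H.1, H.2]
  · intro Ω Λ P _ _ hP m
    refine eq_of_forall_ge_iff fun x => ?_
    simp only [hS]
    refine ⟨fun H j i => H i, fun H i => ?_⟩
    obtain ⟨j, hj⟩ := Set.mem_iUnion.1 (hP.symm ▸ Set.mem_univ i)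
    exact H j ⟨i, hj⟩

namespace CompleteSummation

variable {M : Type u} [AddCommMonoid M] (S : CompleteSummation M)

theorem sum_equiv {Ω Λ : Type u} (f : Λ ≃ Ω) (m : Ω → M) :
    S.sum m = S.sum (fun j => m (f j)) := by
  rw [S.sum_partition (fun j : Λ => {f j}) (fun j => Set.singleton_nonempty _)
    (fun j k hjk => by simpa using fun h => hjk (f.injective h)) ?_ m]
  · congr 1
    funext j
    exact S.sum_singleton (⟨f j, rfl⟩ : ({f j} : Set Ω)) (fun k => Subtype.ext k.2) _
  · ext i
    simp only [Set.mem_iUnion, Set.mem_singleton_iff, Set.mem_univ, iff_true]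
    exact ⟨f.symm i, by simp⟩

theorem sum_eq_add {Ω : Type u} (m : Ω → M) (i : Ω) (hi : ∃ k, k ≠ i) :
    S.sum m = m i + S.sum (fun k : {k // k ≠ i} => m k) := by
  rw [S.sum_partition (fun j : ULift.{u} Bool => if j.down then {i} else {i}ᶜ) ?_ ?_ ?_ m,
    S.sum_pair ⟨true⟩ ⟨false⟩ (by simp) (by rintro ⟨_ | _⟩ <;> simp)]
  · congr 1
    exact S.sum_singleton (⟨i, rfl⟩ : ({i} : Set Ω)) (fun k => Subtype.ext k.2) _
  · rintro ⟨_ | _⟩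
    · exact hi
    · exact Set.singleton_nonempty i
  · rintro ⟨_ | _⟩ ⟨_ | _⟩ h <;> simp_all [disjoint_compl_left]
  · ext k
    simp only [Set.mem_iUnion, Set.mem_univ, iff_true]
    by_cases hk : k = i
    · exact ⟨⟨true⟩, hk⟩
    · exact ⟨⟨false⟩, hk⟩

end CompleteSummation

/-- The sum of all elements, each taken countably often, absorbs every element. -/
theorem CompleteSummation.exists_infinite {M : Type u} [AddCommMonoid M]
    (S : CompleteSummation M) : ∃ a : M, ∀ r : M, r + a = a := by
  classical
  let m : M × ULift.{u} ℕ → M := Prod.fst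
  refine ⟨S.sum m, fun r => ?_⟩
  -- Shifting the copies of `r` by one.
  let f : M × ULift.{u} ℕ ≃ {k : M × ULift.{u} ℕ // k ≠ (r, ⟨0⟩)} :=
    { toFun := fun k =>
        if hk : k.1 = r then
          ⟨(k.1, ⟨k.2.down + 1⟩), by simp [Prod.ext_iff, ULift.ext_iff]⟩
        else ⟨k, fun h => hk (congrArg Prod.fst h)⟩
      invFun := fun k => if k.1.1 = r then (k.1.1, ⟨k.1.2.down - 1⟩) else k.1
      left_inv := by
        rintro ⟨x, ⟨n⟩⟩
        by_cases hx : x = r <;> simp [hx]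
      right_inv := by
        rintro ⟨⟨x, ⟨n⟩⟩, hk⟩
        by_cases hx : x = r
        · subst hx
          have : n ≠ 0 := fun h => hk (by rw [h])
          simp [Nat.sub_add_cancel (Nat.one_le_iff_ne_zero.2 this)]
        · simp [hx] }
  conv_rhs => rw [S.sum_eq_add m (r, ⟨0⟩) ⟨(r, ⟨1⟩), by simp⟩, S.sum_equiv f]
  congr 2
  funext k
  by_cases hk : k.1 = r <;> simp [f, m, hk]

/-! ### Endomorphism semirings of finite distributive lattices -/

namespace EndSemiring

variable {M : Type u} [DistribLattice M] [OrderBot M]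

open Classical in
/-- For a sup-prime element `p` of a lattice, the endomorphism of `(M, ∨, ⊥)` sending `x` to `c`
if `p ≤ x` and to `⊥` otherwise. -/
noncomputable def rankOne (c : M) {p : M} (hp : SupPrime p) : EndSemiring M where
  toFun := fun x : M => (if p ≤ x then c else ⊥ : M)
  map_zero' := if_neg fun h => hp.ne_bot (le_bot_iff.1 h)
  map_add' := fun x y : M => by
    change (if p ≤ x ⊔ y then c else ⊥ : M) = (if p ≤ x then c else ⊥) ⊔ (if p ≤ y then c else ⊥)
    rw [if_congr hp.le_sup rfl rfl]
    by_cases hx : p ≤ x <;> by_cases hy : p ≤ y <;> simp [hx, hy]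

/-- An endomorphism of the monoid `(M, ∨, ⊥)`, as a map of the lattice `M`. -/
def eval (f : EndSemiring M) : M → M := f

theorem ext_eval {f g : EndSemiring M} (h : ∀ x, eval f x = eval g x) : f = g :=
  DFunLike.ext f g h

theorem eval_bot (f : EndSemiring M) : eval f ⊥ = ⊥ := f.map_zero

theorem eval_zero (x : M) : eval (0 : EndSemiring M) x = ⊥ := rfl

theorem eval_one (x : M) : eval (1 : EndSemiring M) x = x := rfl

theorem eval_mul (f g : EndSemiring M) (x : M) : eval (f * g) x = eval f (eval g x) := rfl

theorem eval_add (f g : EndSemiring M) (x : M) : eval (f + g) x = eval f x ⊔ eval g x := rfl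

open Classical in
theorem eval_rankOne (c : M) {p : M} (hp : SupPrime p) (x : M) :
    eval (rankOne c hp) x = if p ≤ x then c else ⊥ := rfl

theorem le_of_forall_supPrime_le [Finite M] {x y : M}
    (h : ∀ p, SupPrime p → p ≤ x → p ≤ y) : x ≤ y := by
  obtain ⟨s, rfl, hs⟩ := exists_supIrred_decomposition x
  exact Finset.sup_le fun p hp =>
    h p (supPrime_iff_supIrred.2 (hs hp)) (Finset.le_sup (f := id) hp)

theorem eval_sum_le_iff {ι : Type*} (s : Finset ι) (f : ι → EndSemiring M) (x y : M) :
    eval (∑ i ∈ s, f i) x ≤ y ↔ ∀ i ∈ s, eval (f i) x ≤ y := by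
  induction s using Finset.cons_induction with
  | empty => simp [eval_zero]
  | cons i s hi ih =>
    rw [Finset.sum_cons, Finset.forall_mem_cons, ← ih, eval_add, sup_le_iff]

/-- The rank one endomorphisms attached to pairs of sup-prime elements are Boolean matrix units:
every element of a finite distributive lattice is the join of the sup-primes below it. -/
noncomputable def booleanMatrixUnits [Finite M] [Fintype {p : M // SupPrime p}] :
    BooleanMatrixUnits {p : M // SupPrime p} (EndSemiring M) where
  E k l := rankOne k.1 l.2
  sum_diag := by
    refine ext_eval fun x => eq_of_forall_ge_iff fun y => ?_
    rw [eval_sum_le_iff, eval_one]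
    refine ⟨fun h => le_of_forall_supPrime_le fun p hp hpx => ?_, fun h i _ => ?_⟩
    · have := h ⟨p, hp⟩ (Finset.mem_univ _)
      rwa [eval_rankOne, if_pos hpx] at this
    · rw [eval_rankOne]
      split_ifs with hi
      exacts [hi.trans h, bot_le]
  mul_mul f i j := by
    by_cases h : i.1 ≤ eval f j.1
    · refine Or.inr fun k l => ext_eval fun x => ?_
      by_cases hx : l.1 ≤ x
      · simp only [eval_mul, eval_rankOne, if_pos hx, if_pos h]
      · simp only [eval_mul, eval_rankOne, if_neg hx, eval_bot]
    · refine Or.inl fun k l => ext_eval fun x => ?_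
      by_cases hx : l.1 ≤ x
      · simp only [eval_mul, eval_rankOne, if_pos hx, if_neg h, eval_zero]
      · simp only [eval_mul, eval_rankOne, if_neg hx, eval_bot, eval_zero]
  one_add_one := ext_eval fun x => sup_idem x

theorem finite [Finite M] : Finite (EndSemiring M) :=
  haveI : Finite (JoinMonoid M) := ‹Finite M›
  DFunLike.finite _

end EndSemiring

/-! ### The lattice of a full idempotent of rank one -/

namespace FullRankOneIdempotent

variable {n : ℕ} {R : Type u} [Semiring R] (d : FullRankOneIdempotent n R)

/-- The left ideal `R e`, as the set of fixed points of right multiplication by `e`. -/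
def leftIdeal : Submodule R R where
  carrier := {x | x * d.e = x}
  add_mem' {x y} hx hy := by
    rw [Set.mem_ofPred_eq] at *
    rw [add_mul, hx, hy]
  zero_mem' := zero_mul _
  smul_mem' r x hx := by
    rw [Set.mem_ofPred_eq] at *
    rw [smul_eq_mul, mul_assoc, hx]

theorem mul_mem (r : R) : r * d.e ∈ d.leftIdeal := by
  change r * d.e * d.e = r * d.e
  rw [mul_assoc, d.mul_self]

/-- The `i`-th coordinate `e bᵢ x ∈ e R e = {0, e}` of an element `x` of `R e`. -/
def coord (i : Fin n) (x : d.leftIdeal) : R := d.e * d.b i * x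

theorem coord_add (i : Fin n) (x y : d.leftIdeal) :
    d.coord i (x + y) = d.coord i x + d.coord i y := mul_add _ _ _

theorem coord_eq (i : Fin n) (x : d.leftIdeal) : d.coord i x = 0 ∨ d.coord i x = d.e := by
  have hx : (x : R) * d.e = x := x.2
  have := d.mul_mul (d.b i * x)
  rwa [mul_assoc, mul_assoc, hx, ← mul_assoc] at this

theorem sum_coord (x : d.leftIdeal) : ∑ i, d.a i * d.coord i x = x := by
  have := congrArg (· * (x : R)) d.sum_eq_one
  simpa only [one_mul, Finset.sum_mul, mul_assoc, coord] using this

theorem mem_coord (i : Fin n) (x : d.leftIdeal) : d.coord i x ∈ d.leftIdeal :=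
  d.leftIdeal.smul_mem _ x.2

/-- The order of `R e` is that of an additively idempotent monoid, and the meet of `x` and `y` is
`∑ aᵢ xᵢ yᵢ`, where `xᵢ` and `yᵢ` are the coordinates of `x` and `y`. Being biadditive, this meet
distributes over joins. -/
@[reducible]
noncomputable def distribLattice : DistribLattice d.leftIdeal :=
  let meet : d.leftIdeal → d.leftIdeal → d.leftIdeal := fun x y =>
    ⟨∑ i, d.a i * (d.coord i x * d.coord i y), Submodule.sum_mem _ fun i _ =>
      d.leftIdeal.smul_mem _ (d.leftIdeal.smul_mem _ (d.mem_coord i y))⟩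
  have meet_add : ∀ x y z, meet x (y + z) = meet x y + meet x z := fun x y z => by
    refine Subtype.ext ?_
    simp only [meet, Submodule.coe_add, coord_add, mul_add, Finset.sum_add_distrib]
  have sum_congr : ∀ {f g : Fin n → R}, (∀ i, f i = g i) →
      ∑ i, d.a i * f i = ∑ i, d.a i * g i := fun h => by simp only [h]
  have add_self : ∀ r : R, r + r = r := add_self_of_one_add_one d.one_add_one
  let L : Lattice d.leftIdeal :=
    { le := fun x y => x + y = y
      le_refl := fun x => Subtype.ext (add_self x)
      le_trans := fun x y z hxy hyz => by rw [← hyz, ← add_assoc, hxy]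
      le_antisymm := fun x y hxy hyx => by rw [← hxy, add_comm]; exact hyx.symm
      sup := (· + ·)
      le_sup_left := fun x y => by
        rw [← add_assoc]; congr 1; exact Subtype.ext (add_self x)
      le_sup_right := fun x y => by
        rw [add_comm, add_assoc]; congr 1; exact Subtype.ext (add_self y)
      sup_le := fun x y z hx hy => by rw [add_assoc, hy, hx]
      inf := meet
      inf_le_left := fun x y => Subtype.ext <| by
        rw [Submodule.coe_add, ← d.sum_coord x, ← Finset.sum_add_distrib]
        simp_rw [← mul_add]
        refine sum_congr fun i => ?_
        rcases d.coord_eq i x with hx | hx <;> rcases d.coord_eq i y with hy | hy <;>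
          simp [hx, hy, d.mul_self, add_self]
      inf_le_right := fun x y => Subtype.ext <| by
        rw [Submodule.coe_add, ← d.sum_coord y, ← Finset.sum_add_distrib]
        simp_rw [← mul_add]
        refine sum_congr fun i => ?_
        rcases d.coord_eq i x with hx | hx <;> rcases d.coord_eq i y with hy | hy <;>
          simp [hx, hy, d.mul_self, add_self]
      le_inf := fun x y z hy hz => Subtype.ext <| by
        rw [Submodule.coe_add, ← d.sum_coord x, ← Finset.sum_add_distrib]
        simp_rw [← mul_add]
        refine sum_congr fun i => ?_
        have hy' := congrArg (d.coord i) hy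
        have hz' := congrArg (d.coord i) hz
        rw [coord_add] at hy' hz'
        rcases d.coord_eq i x with hx | hx <;> rcases d.coord_eq i y with hy | hy <;>
          rcases d.coord_eq i z with hz | hz <;> simp_all [d.mul_self, d.ne_zero] }
  DistribLattice.ofInfSupLe (α := d.leftIdeal) fun x y z => le_of_eq (meet_add x y z)

/-- The least element of `R e` is `0`. -/
@[reducible]
noncomputable def orderBot : letI := d.distribLattice; OrderBot d.leftIdeal :=
  letI := d.distribLattice
  { bot := 0
    bot_le := fun x => zero_add x }

theorem finite_leftIdeal : Finite d.leftIdeal := by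
  refine Finite.of_injective (β := Fin n → ({0, d.e} : Set R))
    (fun x i => ⟨d.coord i x, d.coord_eq i x⟩) fun x y h => Subtype.ext ?_
  rw [← d.sum_coord x, ← d.sum_coord y]
  exact Finset.sum_congr rfl fun i _ =>
    congrArg (d.a i * ·) (congrArg Subtype.val (congrFun h i))

theorem nontrivial_leftIdeal : Nontrivial d.leftIdeal :=
  ⟨0, ⟨d.e, d.mul_self⟩, fun h => d.ne_zero (congrArg Subtype.val h).symm⟩

/-- `R` acts faithfully on `R e`, and every additive endomorphism `f` of `R e` comes from the
element `∑ f(aᵢ e) bᵢ` of `R`. -/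
theorem bijective_toAddMonoidEnd :
    Function.Bijective (Module.toAddMonoidEnd R d.leftIdeal) := by
  constructor
  · intro r s h
    have hrs : ∀ x, r * (x * d.e) = s * (x * d.e) := fun x =>
      congrArg Subtype.val (DFunLike.congr_fun h (⟨x * d.e, d.mul_mem x⟩ : d.leftIdeal))
    calc r = ∑ i, r * (d.a i * d.e) * d.b i := by
            simp_rw [mul_assoc, ← Finset.mul_sum, d.sum_eq_one, mul_one]
      _ = s := by
            simp_rw [hrs, mul_assoc, ← Finset.mul_sum, d.sum_eq_one, mul_one]
  · intro f
    refine ⟨∑ i, (f ⟨d.a i * d.e, d.mul_mem _⟩ : R) * d.b i, ?_⟩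
    refine AddMonoidHom.ext fun x => Subtype.ext ?_
    change (∑ i, (f ⟨d.a i * d.e, d.mul_mem _⟩ : R) * d.b i) * (x : R) = f x
    have hx : x = ∑ i, ⟨d.a i * d.coord i x, d.leftIdeal.smul_mem _ (d.mem_coord i x)⟩ :=
      Subtype.ext <| by rw [AddSubmonoidClass.coe_finsetSum]; exact (d.sum_coord x).symm
    conv_rhs => rw [hx, map_sum, AddSubmonoidClass.coe_finsetSum]
    rw [Finset.sum_mul]
    refine Finset.sum_congr rfl fun i _ => ?_
    -- The values of `f` lie in `R e`, so `bᵢ x` may be replaced by the coordinate `e bᵢ x`.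
    have hf : (f ⟨d.a i * d.e, d.mul_mem _⟩ : R) * d.b i * x
        = (f ⟨d.a i * d.e, d.mul_mem _⟩ : R) * d.coord i x := by
      have : (f ⟨d.a i * d.e, d.mul_mem _⟩ : R) * d.e = f ⟨d.a i * d.e, d.mul_mem _⟩ :=
        (f ⟨d.a i * d.e, d.mul_mem _⟩).2
      rw [coord, ← mul_assoc, ← mul_assoc, this]
    rw [hf]
    rcases d.coord_eq i x with h | h
    · simp only [h, mul_zero]
      exact (congrArg Subtype.val (map_zero f)).symm
    · simp only [h]
      exact (f ⟨d.a i * d.e, d.mul_mem _⟩).2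

/-- `R` is the endomorphism semiring of the finite distributive lattice `R e`. -/
theorem exists_ringEquiv_endSemiring {n : ℕ} {R : Type u} [Semiring R]
    (d : FullRankOneIdempotent n R) :
    ∃ (M : Type u) (_ : DistribLattice M) (_ : OrderBot M),
      Finite M ∧ Nontrivial M ∧ Nonempty (R ≃+* EndSemiring M) := by
  refine ⟨d.leftIdeal, d.distribLattice, d.orderBot, d.finite_leftIdeal, d.nontrivial_leftIdeal,
    ⟨?_⟩⟩
  letI := d.distribLattice
  letI := d.orderBot
  -- The join of `d.distribLattice` is by definition the addition of `R e`.
  let ε : d.leftIdeal ≃+ JoinMonoid d.leftIdeal :=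
    { Equiv.refl _ with map_add' := fun _ _ => rfl }
  let φ : AddMonoid.End d.leftIdeal ≃+* EndSemiring d.leftIdeal :=
    { toFun := fun f => (ε.toAddMonoidHom.comp f).comp ε.symm.toAddMonoidHom
      invFun := fun f => (ε.symm.toAddMonoidHom.comp f).comp ε.toAddMonoidHom
      left_inv := fun _ => rfl
      right_inv := fun _ => rfl
      map_mul' := fun _ _ => rfl
      map_add' := fun _ _ => rfl }
  exact (RingEquiv.ofBijective _ d.bijective_toAddMonoidEnd).trans φ

end FullRankOneIdempotent

/-! ### Semimodules over the Boolean semifield -/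

namespace BooleanSemifield

theorem eq_zero_or_one : ∀ b : BooleanSemifield, b = 0 ∨ b = 1 := by decide

theorem one_ne_zero' : (1 : BooleanSemifield) ≠ 0 := by decide

theorem one_add_one : (1 : BooleanSemifield) + 1 = 1 := rfl

/-- An idempotent commutative monoid is a semimodule over the Boolean semifield in a unique
way. -/
@[reducible]
def module (A : Type u) [AddCommMonoid A] (h : ∀ a : A, a + a = a) : Module BooleanSemifield A where
  smul b a := if b = 1 then a else 0
  one_smul a := if_pos rfl
  mul_smul b c a := by
    change (if b * c = 1 then a else 0) = if b = 1 then (if c = 1 then a else 0) else 0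
    rcases eq_zero_or_one b with rfl | rfl <;> simp [one_ne_zero'.symm]
  smul_zero b := ite_self 0
  smul_add b x y := by
    change (if b = 1 then x + y else 0) = (if b = 1 then x else 0) + if b = 1 then y else 0
    split_ifs <;> simp
  add_smul b c x := by
    change (if b + c = 1 then x else 0) = (if b = 1 then x else 0) + if c = 1 then x else 0
    rcases eq_zero_or_one b with rfl | rfl <;> rcases eq_zero_or_one c with rfl | rfl <;>
      simp [one_ne_zero'.symm, one_add_one, h]
  zero_smul x := if_neg one_ne_zero'.symm

/-- Additive maps between semimodules over the Boolean semifield are linear. -/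
def toLinearMap {A B : Type*} [AddCommMonoid A] [AddCommMonoid B] [Module BooleanSemifield A]
    [Module BooleanSemifield B] (f : A →+ B) : A →ₗ[BooleanSemifield] B where
  __ := f
  map_smul' b x := by
    rcases eq_zero_or_one b with rfl | rfl
    · simp
    · simp

theorem add_self {A : Type*} [AddCommMonoid A] [Module BooleanSemifield A] (x : A) :
    x + x = x := by
  rw [← one_smul BooleanSemifield x, ← add_smul, one_add_one]

end BooleanSemifield

/-! ### The Morita equivalence defined by a full idempotent of rank one -/

namespace FullRankOneIdempotent

open CategoryTheory

variable {n : ℕ} {R : Type u} [Semiring R] (d : FullRankOneIdempotent n R)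

section Corner

variable (N : Type v) [AddCommMonoid N] [Module R N]

/-- The part `e N` of a left `R`-semimodule `N`. -/
def corner : AddSubmonoid N where
  carrier := {x | d.e • x = x}
  add_mem' {x y} hx hy := by
    rw [Set.mem_ofPred_eq] at *
    rw [smul_add, hx, hy]
  zero_mem' := smul_zero _

theorem smul_mem_corner (x : N) : d.e • x ∈ d.corner N := by
  change d.e • d.e • x = d.e • x
  rw [← mul_smul, d.mul_self]

instance : Module BooleanSemifield (d.corner N) :=
  BooleanSemifield.module _ fun x => Subtype.ext <| by
    change (x : N) + x = x
    rw [← one_smul R (x : N), ← add_smul, d.one_add_one]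

end Corner

variable {N N' : Type v} [AddCommMonoid N] [Module R N] [AddCommMonoid N'] [Module R N']

theorem sum_smul (x : N) : ∑ i, d.a i • (d.e • d.b i • x) = x := by
  simpa only [one_smul, Finset.sum_smul, mul_smul] using congrArg (· • x) d.sum_eq_one

/-- The restriction `e N → e N'` of an `R`-linear map `N → N'`. -/
def cornerMap (f : N →ₗ[R] N') : d.corner N →ₗ[BooleanSemifield] d.corner N' :=
  BooleanSemifield.toLinearMap
    { toFun := fun x => ⟨f x, by
        change d.e • f x = f x
        rw [← map_smul]
        exact congrArg f x.2⟩
      map_zero' := Subtype.ext (map_zero f)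
      map_add' := fun x y => Subtype.ext (map_add f _ _) }

theorem cornerMap_injective :
    Function.Injective (d.cornerMap : (N →ₗ[R] N') → _) := by
  intro f g h
  ext x
  have hfg : ∀ y, f (d.e • y) = g (d.e • y) := fun y =>
    congrArg Subtype.val (DFunLike.congr_fun h (⟨d.e • y, d.smul_mem_corner N y⟩ : d.corner N))
  rw [← d.sum_smul x]
  simp only [map_sum, map_smul f (d.a _), map_smul g (d.a _), hfg]

/-- An additive map `g : e N → e N'` extends to the `R`-linear map `x ↦ ∑ aᵢ g(e bᵢ x)`, because
it commutes with the action of `e R e = {0, e}`. -/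
theorem cornerMap_surjective :
    Function.Surjective (d.cornerMap : (N →ₗ[R] N') → _) := by
  intro g
  classical
  let q : N →+ d.corner N :=
    { toFun := fun x => ⟨d.e • x, d.smul_mem_corner N x⟩
      map_zero' := Subtype.ext (smul_zero _)
      map_add' := fun x y => Subtype.ext (smul_add _ _ _) }
  have hq : ∀ x : d.corner N, q x = x := fun x => Subtype.ext x.2
  have hg : ∀ (r : R) (x : N), d.e • r • (g (q x) : N') = g (q (r • d.e • x)) := by
    intro r x
    have h1 : (g (q x) : N') = d.e • (g (q x) : N') := (g (q x)).2.symm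
    have h2 : q (r • d.e • x) = (if d.e * r * d.e = 0 then 0 else q x) := by
      refine Subtype.ext ?_
      change d.e • r • d.e • x = _
      rw [← mul_smul, ← mul_smul]
      rcases d.mul_mul r with h | h
      · rw [h, if_pos rfl, zero_smul]; rfl
      · rw [h, if_neg d.ne_zero]; rfl
    rw [h2, h1, ← mul_smul, ← mul_smul]
    rcases d.mul_mul r with h | h
    · rw [h, if_pos rfl, zero_smul, map_zero]; rfl
    · rw [h, if_neg d.ne_zero, ← h1]
  let f : N →ₗ[R] N' :=
    { toFun := fun x => ∑ i, d.a i • (g (q (d.b i • x)) : N')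
      map_add' := fun x y => by
        simp only [smul_add, map_add, AddSubmonoid.coe_add, Finset.sum_add_distrib]
      map_smul' := fun r x => by
        have : ∀ i, (g (q (d.b i • r • x)) : N')
            = ∑ j, d.e • d.b i • r • d.a j • (g (q (d.b j • x)) : N') := by
          intro i
          conv_lhs => rw [← d.sum_smul x]
          simp only [Finset.smul_sum, map_sum, AddSubmonoid.coe_finsetSum]
          refine Finset.sum_congr rfl fun j _ => ?_
          simpa only [mul_smul] using (hg (d.b i * r * d.a j) (d.b j • x)).symm
        simp only [this, RingHom.id_apply]
        conv_rhs => rw [← d.sum_smul (r • _)]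
        simp only [Finset.smul_sum] }
  refine ⟨f, LinearMap.ext fun x => Subtype.ext ?_⟩
  change ∑ i, d.a i • (g (q (d.b i • (x : N))) : N') = g x
  conv_rhs => rw [← d.sum_smul (g x : N')]
  refine Finset.sum_congr rfl fun i _ => ?_
  have h := hg (d.b i) x
  rw [hq] at h
  rw [h]
  congr 5
  exact x.2.symm

/-- The functor `N ↦ e N` from `R`-semimodules to semimodules over the Boolean semifield. -/
def cornerFunctor : SemimoduleCat.{v} R ⥤ SemimoduleCat.{v} BooleanSemifield where
  obj N := SemimoduleCat.of _ (d.corner N)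
  map f := SemimoduleCat.ofHom (d.cornerMap f.hom)
  map_id _ := rfl
  map_comp _ _ := rfl

instance : d.cornerFunctor.Faithful where
  map_injective h := SemimoduleCat.hom_ext (d.cornerMap_injective
    (congrArg SemimoduleCat.Hom.hom h))

instance : d.cornerFunctor.Full where
  map_surjective g := by
    obtain ⟨f, hf⟩ := d.cornerMap_surjective g.hom
    exact ⟨SemimoduleCat.ofHom f, SemimoduleCat.hom_ext hf⟩

/-- The left `R`-semimodule of additive maps `e R → K`, encoded as the additive maps on `R` that
are invariant under left multiplication by `e`. -/
def coinduced (K : Type v) [AddCommMonoid K] : AddSubmonoid (R →+ K) where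
  carrier := {f | ∀ x, f (d.e * x) = f x}
  add_mem' {f g} hf hg x := by
    rw [AddMonoidHom.add_apply, AddMonoidHom.add_apply, hf, hg]
  zero_mem' _ := rfl

/-- `R` acts on additive maps `e R → K` through right multiplication on `e R`. -/
instance (K : Type v) [AddCommMonoid K] : Module R (d.coinduced K) where
  smul r f := ⟨f.1.comp (AddMonoidHom.mulRight r), fun x => by
    change f.1 (d.e * x * r) = f.1 (x * r)
    rw [mul_assoc, f.2]⟩
  one_smul f := Subtype.ext <| AddMonoidHom.ext fun x => congrArg f.1 (mul_one x)
  mul_smul r s f := Subtype.ext <| AddMonoidHom.ext fun x =>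
    congrArg f.1 (mul_assoc x r s).symm
  smul_zero _ := rfl
  smul_add _ _ _ := rfl
  add_smul r s f := Subtype.ext <| AddMonoidHom.ext fun x =>
    (congrArg f.1 (mul_add x r s)).trans (map_add f.1 _ _)
  zero_smul f := Subtype.ext <| AddMonoidHom.ext fun x =>
    (congrArg f.1 (mul_zero x)).trans (map_zero f.1)

theorem coe_smul_coinduced {K : Type v} [AddCommMonoid K] (r : R) (f : d.coinduced K) (x : R) :
    (r • f).1 x = f.1 (x * r) := rfl

open Classical in
/-- Since `e R e = {0, e}`, an additive map on `e R` fixed by `e` is determined by its value at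
`e`, which can be chosen freely. -/
noncomputable def cornerCoinducedEquiv (K : Type v) [AddCommMonoid K]
    [Module BooleanSemifield K] :
    d.corner (d.coinduced K) ≃ₗ[BooleanSemifield] K :=
  LinearEquiv.ofBijective
    (BooleanSemifield.toLinearMap
      { toFun := fun f => f.1.1 d.e
        map_zero' := rfl
        map_add' := fun _ _ => rfl }) <| by
    have hval : ∀ (f : d.corner (d.coinduced K)) (x : R),
        f.1.1 x = f.1.1 (d.e * x * d.e) := fun f x => by
      have h : d.e • f.1 = f.1 := f.2
      rw [mul_assoc, f.1.2, ← d.coe_smul_coinduced, h]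
    constructor
    · intro f g h
      have h : f.1.1 d.e = g.1.1 d.e := h
      refine Subtype.ext <| Subtype.ext <| AddMonoidHom.ext fun x => ?_
      rw [hval f, hval g]
      rcases d.mul_mul x with hx | hx <;> rw [hx]
      · rw [map_zero, map_zero]
      · exact h
    · intro k
      let f : R →+ K :=
        { toFun := fun x => if d.e * x * d.e = 0 then 0 else k
          map_zero' := by simp
          map_add' := fun x y => by
            rw [mul_add, add_mul]
            rcases d.mul_mul x with hx | hx <;> rcases d.mul_mul y with hy | hy <;>
              simp [hx, hy, d.ne_zero, add_self_of_one_add_one d.one_add_one,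
                BooleanSemifield.add_self] }
      have hf : ∀ x, f x = if d.e * x * d.e = 0 then 0 else k := fun _ => rfl
      refine ⟨⟨⟨f, fun x => ?_⟩, Subtype.ext <| AddMonoidHom.ext fun x => ?_⟩, ?_⟩
      · rw [hf, hf, ← mul_assoc, d.mul_self]
      · change f (x * d.e) = f x
        rw [hf, hf, mul_assoc, mul_assoc, d.mul_self, mul_assoc]
      · change f d.e = k
        rw [hf, d.mul_self, d.mul_self, if_neg d.ne_zero]

/-- For essential surjectivity, the semimodules must live in a universe that contains `R`. -/
instance : (cornerFunctor.{u, u} d).EssSurj where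
  mem_essImage K :=
    ⟨SemimoduleCat.of R (d.coinduced K), ⟨(d.cornerCoinducedEquiv K).toModuleIsoₛ⟩⟩

instance : (cornerFunctor.{u, u} d).IsEquivalence where

end FullRankOneIdempotent

theorem IsAdditiveFunctor.inverse {R : Type u} {S : Type v} [Semiring R] [Semiring S]
    {e : CategoryTheory.Equivalence
      (SemimoduleCat.{max u v} R) (SemimoduleCat.{max u v} S)}
    (h : IsAdditiveFunctor.{u, v} e.functor) : IsAdditiveFunctor.{v, u} e.inverse := by
  intro M N
  refine ⟨e.functor.map_injective ?_, fun f g => e.functor.map_injective ?_⟩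
  · rw [(h _ _).1, e.fun_inv_map]
    simp
  · rw [(h _ _).2, e.fun_inv_map, e.fun_inv_map, e.fun_inv_map]
    ext x
    simp

theorem FullRankOneIdempotent.areMoritaEquivalent {n : ℕ} {R : Type u} [Semiring R]
    (d : FullRankOneIdempotent n R) : AreMoritaEquivalent R BooleanSemifield := by
  have h : IsAdditiveFunctor.{u, 0} d.cornerFunctor.asEquivalence.functor :=
    fun _ _ => ⟨rfl, fun _ _ => rfl⟩
  exact ⟨_, h, h.inverse⟩

/-! ### Matrix units from a Morita equivalence -/

section Morita

open CategoryTheory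

/-- The Boolean semifield as a semimodule over itself, in an arbitrary universe. -/
abbrev BooleanSemifield.regular : SemimoduleCat.{u} BooleanSemifield :=
  SemimoduleCat.of BooleanSemifield (ULift.{u} BooleanSemifield)

namespace BooleanSemifield

/-- The morphism from the free semimodule on one generator that selects an element. -/
def select {K : SemimoduleCat.{u} BooleanSemifield} (x : K) : regular.{u} ⟶ K :=
  SemimoduleCat.ofHom ((LinearMap.toSpanSingleton BooleanSemifield K x).comp
    ULift.moduleEquiv.toLinearMap)

theorem select_one {K : SemimoduleCat.{u} BooleanSemifield} (x : K) :
    (select x).hom ⟨1⟩ = x := one_smul _ x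

theorem regular_hom_ext {K : SemimoduleCat.{u} BooleanSemifield} {f g : regular.{u} ⟶ K}
    (h : f.hom ⟨1⟩ = g.hom ⟨1⟩) : f = g := by
  refine SemimoduleCat.hom_ext (LinearMap.ext ?_)
  rintro ⟨b⟩
  rcases eq_zero_or_one b with rfl | rfl
  · exact (map_zero f.hom).trans (map_zero g.hom).symm
  · exact h

theorem regular_end_eq (f : regular.{u} ⟶ regular.{u}) : f = 0 ∨ f = 𝟙 _ :=
  (eq_zero_or_one (f.hom ⟨1⟩).down).imp (fun h => regular_hom_ext (ULift.ext _ _ h))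
    fun h => regular_hom_ext (ULift.ext _ _ h)

theorem regular_id_add_id : 𝟙 regular.{u} + 𝟙 regular.{u} = 𝟙 regular.{u} :=
  regular_hom_ext rfl

/-- The Boolean semifield is a strong generator: a monomorphism through which all its morphisms to
the target factor is bijective. -/
theorem isIso_of_forall_factor {K L : SemimoduleCat.{u} BooleanSemifield} (i : K ⟶ L) [Mono i]
    (h : ∀ z : regular.{u} ⟶ L, ∃ t, t ≫ i = z) : IsIso i := by
  have hbij : Function.Bijective i.hom := by
    constructor
    · intro x y hxy
      have hs : select x ≫ i = select y ≫ i := regular_hom_ext <| by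
        change i.hom ((select x).hom ⟨1⟩) = i.hom ((select y).hom ⟨1⟩)
        rw [select_one, select_one, hxy]
      rw [← select_one x, (cancel_mono i).1 hs, select_one]
    · intro z
      obtain ⟨t, ht⟩ := h (select z)
      refine ⟨t.hom ⟨1⟩, ?_⟩
      rw [← select_one z, ← ht]
      rfl
  exact (LinearEquiv.ofBijective i.hom hbij).toModuleIsoₛ.isIso_hom

end BooleanSemifield

variable {R : Type u} [Semiring R]

/-- Under an equivalence of the semimodule categories, the semimodule `Q` corresponding to the
Boolean semifield is a strong generator, so its trace ideal in `R` is everything. -/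
theorem one_mem_trace (e : SemimoduleCat.{u} R ≌ SemimoduleCat.{u} BooleanSemifield) :
    (1 : R) ∈ Submodule.span R {r : R | ∃ (f : e.inverse.obj BooleanSemifield.regular ⟶
      SemimoduleCat.of R R) (q : e.inverse.obj BooleanSemifield.regular), f.hom q = r} := by
  set T := Submodule.span R {r : R | ∃ (f : e.inverse.obj BooleanSemifield.regular ⟶
      SemimoduleCat.of R R) (q : e.inverse.obj BooleanSemifield.regular), f.hom q = r} with hT
  let i : SemimoduleCat.of R T ⟶ SemimoduleCat.of R R := SemimoduleCat.ofHom T.subtype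
  have hmono : Mono i := ConcreteCategory.mono_of_injective i T.injective_subtype
  let adj := e.symm.toAdjunction
  have hiso : IsIso (e.functor.map i) := by
    refine BooleanSemifield.isIso_of_forall_factor _ fun z => ?_
    let z' := (adj.homEquiv _ _).symm z
    let t : e.inverse.obj BooleanSemifield.regular ⟶ SemimoduleCat.of R T :=
      SemimoduleCat.ofHom (z'.hom.codRestrict T fun q => Submodule.subset_span ⟨z', q, rfl⟩)
    have ht : t ≫ i = z' := rfl
    refine ⟨adj.homEquiv _ _ t, ?_⟩
    have := adj.homEquiv_naturality_right t i
    rw [ht, Equiv.apply_symm_apply] at this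
    exact this.symm
  have : IsIso i := isIso_of_reflects_iso i e.functor
  obtain ⟨x, hx⟩ := (asIso i).toLinearEquivₛ.surjective (1 : R)
  have hx' : (x : R) = 1 := hx
  rw [← hx']
  exact x.2

/-- A decomposition `1 = ∑ fᵢ(qᵢ)` with `qᵢ ∈ Q` and `fᵢ : Q → R` yields the matrix
units `fₗ(qₖ)`, because the endomorphisms of `Q` are `0` and `1`. -/
theorem AreMoritaEquivalent.exists_booleanMatrixUnits
    (h : AreMoritaEquivalent R BooleanSemifield) :
    ∃ n, Nonempty (BooleanMatrixUnits (Fin n) R) := by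
  obtain ⟨e, -, hadd⟩ := h
  let Q := e.inverse.obj BooleanSemifield.regular
  have hQ : ∀ φ : Q ⟶ Q, φ = 0 ∨ φ = 𝟙 Q := by
    intro φ
    obtain ⟨ψ, rfl⟩ := e.inverse.map_surjective φ
    rcases BooleanSemifield.regular_end_eq ψ with rfl | rfl
    · exact Or.inl (hadd _ _).1
    · exact Or.inr (e.inverse.map_id _)
  have hidem : ∀ q : Q, q + q = q := by
    have := (hadd _ _).2 (𝟙 BooleanSemifield.regular) (𝟙 _)
    rw [BooleanSemifield.regular_id_add_id, e.inverse.map_id] at this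
    exact fun q => (DFunLike.congr_fun (congrArg SemimoduleCat.Hom.hom this) q).symm
  obtain ⟨n, a, g, hg⟩ := Submodule.mem_span_set'.1 (one_mem_trace e)
  choose f q hfq using fun i => (g i).2
  have hsum : ∑ i, (f i).hom (a i • q i) = 1 := by
    rw [← hg]
    refine Finset.sum_congr rfl fun i _ => ?_
    rw [map_smul, hfq]
  refine ⟨n, ⟨fun k l => (f l).hom (a k • q k), hsum, fun r i j => ?_, ?_⟩⟩
  · let φ : Q ⟶ Q := f i ≫ SemimoduleCat.ofHom (LinearMap.toSpanSingleton R Q (r • a j • q j))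
    have hφ : ∀ k l, (f i).hom (a k • q k) * r * (f l).hom (a j • q j)
        = (f l).hom (φ.hom (a k • q k)) := by
      intro k l
      change _ = (f l).hom ((f i).hom (a k • q k) • r • a j • q j)
      rw [map_smul (f l).hom ((f i).hom _), map_smul (f l).hom r, smul_eq_mul, smul_eq_mul,
        mul_assoc]
    rcases hQ φ with h | h
    · refine Or.inl fun k l => (hφ k l).trans ?_
      rw [h]
      exact map_zero _
    · refine Or.inr fun k l => (hφ k l).trans ?_
      rw [h]
      rfl
  · rw [← hsum, ← Finset.sum_add_distrib]
    refine Finset.sum_congr rfl fun i _ => ?_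
    rw [← map_add, hidem]

end Morita

theorem theorem5p7 (R : Type u) [Semiring R] [Nontrivial R] :
    List.TFAE [
      IsSimpleSemiring R ∧ HasInfiniteElement R,
      AreMoritaEquivalent R BooleanSemifield,
      ∃ (M : Type u) (_ : DistribLattice M) (_ : OrderBot M),
        Finite M ∧ Nontrivial M ∧ Nonempty (R ≃+* EndSemiring M),
      IsSimpleSemiring R ∧ IsCompleteSemiring R] := by
  tfae_have 1 → 2 := fun ⟨hs, hi⟩ =>
    let ⟨_, ⟨d⟩⟩ := hs.2.exists_fullRankOneIdempotent hi
    d.areMoritaEquivalent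
  tfae_have 2 → 1 := fun h =>
    let ⟨_, ⟨m⟩⟩ := h.exists_booleanMatrixUnits
    ⟨m.isSimpleSemiring, m.hasInfiniteElement⟩
  tfae_have 1 → 3 := fun ⟨hs, hi⟩ =>
    let ⟨_, ⟨d⟩⟩ := hs.2.exists_fullRankOneIdempotent hi
    d.exists_ringEquiv_endSemiring
  tfae_have 3 → 4 := by
    rintro ⟨M, _, _, _, -, ⟨f⟩⟩
    have : Fintype {p : M // SupPrime p} := Fintype.ofFinite _
    have : Finite (EndSemiring M) := EndSemiring.finite
    have : Finite R := Finite.of_equiv _ f.symm.toEquiv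
    let m := (EndSemiring.booleanMatrixUnits (M := M)).map f.symm
    exact ⟨m.isSimpleSemiring, isCompleteSemiring_of_finite m.one_add_one⟩
  tfae_have 4 → 1 := fun ⟨hs, S, _⟩ => ⟨hs, S.exists_infinite⟩
  tfae_finish
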